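/- Conventions. A metric space is proper if its closed balls are compact. A CAT(0) space is a geodesic metric space whose geodesic triangles are no thicker than their comparison triangles in the Euclidean plane. It is without Euclidean factor if it is not isometric to an $\ell^2$-product $\mathbf{R}^n\times Y$ with $n\geq 1$ and $Y$ a metric space. A group acting by isometries on a CAT(0) space $X$ acts minimally if it stabilises no non-empty closed convex proper subset of $X$. The boundary $\partial X$ is the set of geodesic rays $[0,\infty)\to X$ modulo the relation of staying at bounded distance from each other, with the induced action. A closed subgroup $H$ of a locally compact group $G$ has finite invariant covolume if $G/H$ carries a non-zero finite $G$-invariant Borel measure. Theorem. Let $G$ be a locally compact group with a continuous isometric action on a proper CAT(0) space $X$ without Euclidean factor. If $G$ acts minimally and without global fixed point in $\partial X$, then every closed subgroup $H\leq G$ of finite invariant covolume also acts minimally on $X$ and without global fixed point in $\partial X$. -/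

import Mathlib

open Set MeasureTheory
open scoped NNReal

/-- `c` restricted to `[0, 1]` is a geodesic from `x` to `y`, parametrised proportionally to
arc length. -/
def IsGeodesicFromTo {X : Type*} [MetricSpace X] (c : ℝ → X) (x y : X) : Prop :=
  c 0 = x ∧ c 1 = y ∧
    ∀ s ∈ Icc (0 : ℝ) 1, ∀ t ∈ Icc (0 : ℝ) 1, dist (c s) (c t) = |s - t| * dist x y

/-- CAT(0) spaces: geodesic metric spaces all of whose geodesic triangles are at least as thin as
their comparison triangles `x' y' z'` in the Euclidean plane. Two distinct sides of a triangle
always share a vertex, here called `x`. -/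
structure IsCAT0 (X : Type*) [MetricSpace X] : Prop where
  exists_geodesic : ∀ x y : X, ∃ c : ℝ → X, IsGeodesicFromTo c x y
  comparison : ∀ (x y z : X) (c₁ c₂ : ℝ → X),
    IsGeodesicFromTo c₁ x y → IsGeodesicFromTo c₂ x z →
    ∀ x' y' z' : EuclideanSpace ℝ (Fin 2),
      dist x' y' = dist x y → dist x' z' = dist x z → dist y' z' = dist y z →
      ∀ s ∈ Icc (0 : ℝ) 1, ∀ t ∈ Icc (0 : ℝ) 1,
        dist (c₁ s) (c₂ t) ≤ dist (AffineMap.lineMap x' y' s) (AffineMap.lineMap x' z' t)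

/-- `X` is not isometric to an `ℓ²`-product `ℝⁿ × Y` with `n ≥ 1`. (Such a `Y` is isometric to a
subset of `X`, so that one universe is enough.) -/
def WithoutEuclideanFactor.{u} (X : Type u) [MetricSpace X] : Prop :=
  ∀ (n : ℕ) (Y : Type u) [MetricSpace Y], 1 ≤ n →
    IsEmpty (X ≃ᵢ WithLp 2 (EuclideanSpace ℝ (Fin n) × Y))

/-- Geodesic convexity: `C` contains every geodesic segment between two of its points. -/
def IsGeodesicallyConvex {X : Type*} [MetricSpace X] (C : Set X) : Prop :=
  ∀ x ∈ C, ∀ y ∈ C, ∀ c : ℝ → X, IsGeodesicFromTo c x y → ∀ t ∈ Icc (0 : ℝ) 1, c t ∈ C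

/-- The action stabilises no non-empty closed convex proper subset. -/
def ActsMinimally (G X : Type*) [Group G] [MetricSpace X] [MulAction G X] : Prop :=
  ∀ C : Set X, C.Nonempty → IsClosed C → IsGeodesicallyConvex C →
    (∀ g : G, ∀ x ∈ C, g • x ∈ C) → C = univ

/-- Geodesic rays `[0, ∞) → X`, parametrised by arc length. -/
structure GeodesicRay (X : Type*) [MetricSpace X] where
  toFun : ℝ≥0 → X
  isometry : Isometry toFun

/-- Two rays are asymptotic if they stay at bounded distance from each other. -/
def GeodesicRay.Asymptotic {X : Type*} [MetricSpace X] (r r' : GeodesicRay X) : Prop :=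
  ∃ K : ℝ, ∀ t : ℝ≥0, dist (r.toFun t) (r'.toFun t) ≤ K

instance GeodesicRay.setoid (X : Type*) [MetricSpace X] : Setoid (GeodesicRay X) where
  r := GeodesicRay.Asymptotic
  iseqv :=
    { refl := fun r => ⟨0, fun t => (dist_self (r.toFun t)).le⟩
      symm := fun ⟨K, hK⟩ => ⟨K, fun t => (dist_comm _ _).trans_le (hK t)⟩
      trans := fun ⟨K, hK⟩ ⟨L, hL⟩ =>
        ⟨K + L, fun t => (dist_triangle _ _ _).trans (add_le_add (hK t) (hL t))⟩ }

/-- The boundary at infinity `∂X`: asymptote classes of geodesic rays. -/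
def BoundaryAtInfinity (X : Type*) [MetricSpace X] : Type _ := Quotient (GeodesicRay.setoid X)

/-- The image of a ray under an isometry. -/
def GeodesicRay.translate {G X : Type*} [Group G] [MetricSpace X] [MulAction G X]
    [IsIsometricSMul G X] (g : G) (r : GeodesicRay X) : GeodesicRay X where
  toFun t := g • r.toFun t
  isometry := (isometry_smul X g).comp r.isometry

/-- The induced action on the boundary at infinity. -/
instance BoundaryAtInfinity.mulAction (G X : Type*) [Group G] [MetricSpace X] [MulAction G X]
    [IsIsometricSMul G X] : MulAction G (BoundaryAtInfinity X) where
  smul g := Quotient.map (GeodesicRay.translate g) fun _ _ ⟨K, hK⟩ =>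
    ⟨K, fun t => (dist_smul g _ _).trans_le (hK t)⟩
  one_smul := by
    rintro ⟨r⟩
    exact Quotient.sound ⟨0, fun t => by simp [GeodesicRay.translate]⟩
  mul_smul g h := by
    rintro ⟨r⟩
    exact Quotient.sound ⟨0, fun t => by simp [GeodesicRay.translate, mul_smul]⟩

/-- A subgroup acts by isometries as well. -/
instance Subgroup.isIsometricSMul_of_isIsometricSMul {G X : Type*} [Group G] [MetricSpace X]
    [MulAction G X] [IsIsometricSMul G X] (H : Subgroup G) : IsIsometricSMul H X :=
  ⟨fun h => isometry_smul X (h : G)⟩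

/-- No point of `∂X` is fixed by all of `G`. -/
def NoFixedPointAtInfinity (G X : Type*) [Group G] [MetricSpace X] [MulAction G X]
    [IsIsometricSMul G X] : Prop :=
  ¬ ∃ ξ : BoundaryAtInfinity X, ∀ g : G, g • ξ = ξ

/-- `G ⧸ H` carries a non-zero finite Borel measure that is invariant under left translation
by `G`. -/
def HasFiniteInvariantCovolume {G : Type*} [Group G] [TopologicalSpace G] (H : Subgroup G) :
    Prop :=
  ∃ μ : @Measure (G ⧸ H) (borel (G ⧸ H)),
    μ ≠ 0 ∧ @IsFiniteMeasure (G ⧸ H) (borel (G ⧸ H)) μ ∧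
      @SMulInvariantMeasure G (G ⧸ H) _ (borel (G ⧸ H)) μ

/-! Everything rests on Lipschitz convex functions `f` that a group preserves up to additive
constants. If `G` is minimal without fixed point at infinity, such an `f` for `G` is constant
(`ActsMinimally.eq_of_quasiInvariant`). Indeed, a non-zero constant makes `f` decrease linearly
somewhere; a ray of steepest descent then exists and is unique up to asymptoty, so `G` fixes its
endpoint. Hence `f` is invariant, its sublevel sets are invariant closed convex sets, and minimality
applies.

For `H` of finite covolume, the differences `f (g⁻¹ • x) - f (g⁻¹ • o)` descend to `G ⧸ H`. Their
integral over the quotient is a function of `x` of the above kind for `G`, hence constant. The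
convexity inequality of the integrand is therefore an equality almost everywhere, so `f` itself is
affine (`QuasiInvariant.affine`).

Two choices of `f` give the theorem. If `C` is closed, convex and `H`-invariant, both the distance
to `C` and its truncation from below are affine, which forces `C` to be everything. If `H` fixes a
point at infinity, a Busemann function of that point is affine; minimality of `H` spreads its unit
slope along one ray to all of `X`, and the resulting flow splits off a line
(`IsUnitGradientFlow.nonempty_isometryEquiv`), which is excluded. -/

/-! ### Comparison triangles and the basic CAT(0) inequalities -/

theorem exists_planar_apex {a b e : ℝ} (ha : 0 ≤ a)
    (h₁ : a ≤ b + e) (h₂ : b ≤ a + e) (h₃ : e ≤ a + b) :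
    ∃ u v : ℝ, u ^ 2 + v ^ 2 = b ^ 2 ∧ (a - u) ^ 2 + v ^ 2 = e ^ 2 := by
  rcases ha.eq_or_lt with rfl | ha
  · have : b = e := by linarith
    exact ⟨b, 0, by ring, by rw [this]; ring⟩
  · set u := (a ^ 2 + b ^ 2 - e ^ 2) / (2 * a) with hu
    have hua : 2 * a * u = a ^ 2 + b ^ 2 - e ^ 2 := by rw [hu]; field_simp
    have hub : u ^ 2 ≤ b ^ 2 := by
      have h₄ : u ≤ b := by
        rw [hu, div_le_iff₀ (by positivity)]
        nlinarith
      have h₅ : -b ≤ u := by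
        rw [hu, le_div_iff₀ (by positivity)]
        nlinarith
      exact sq_le_sq' h₅ h₄
    refine ⟨u, √(b ^ 2 - u ^ 2), ?_, ?_⟩ <;> rw [Real.sq_sqrt (by linarith)]
    · ring
    · linarith

theorem exists_comparison_triangle {X : Type*} [MetricSpace X] (x y z : X) :
    ∃ x' y' z' : EuclideanSpace ℝ (Fin 2),
      dist x' y' = dist x y ∧ dist x' z' = dist x z ∧ dist y' z' = dist y z := by
  obtain ⟨u, v, h₁, h₂⟩ := exists_planar_apex (a := dist x y) (b := dist x z) (e := dist y z)
    dist_nonneg (by rw [dist_comm y z]; exact dist_triangle _ _ _)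
    (dist_triangle _ _ _) (by rw [dist_comm x y]; exact dist_triangle _ _ _)
  refine ⟨!₂[0, 0], !₂[dist x y, 0], !₂[u, v], ?_, ?_, ?_⟩
  · simp [EuclideanSpace.dist_eq, Real.dist_eq]
  · simp [EuclideanSpace.dist_eq, Real.dist_eq, h₁]
  · simp [EuclideanSpace.dist_eq, Real.dist_eq, h₂]

theorem dist_lineMap_sq {E : Type*} [NormedAddCommGroup E] [InnerProductSpace ℝ E]
    (x y z : E) (t : ℝ) :
    dist x (AffineMap.lineMap y z t) ^ 2 =
      (1 - t) * dist x y ^ 2 + t * dist x z ^ 2 - t * (1 - t) * dist y z ^ 2 := by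
  have h₁ : x - AffineMap.lineMap y z t = (1 - t) • (x - y) + t • (x - z) := by
    rw [AffineMap.lineMap_apply_module]; module
  have h₂ : y - z = (x - z) - (x - y) := by abel
  rw [dist_eq_norm, dist_eq_norm, dist_eq_norm, dist_eq_norm, h₁, h₂, norm_add_sq_real,
    norm_sub_sq_real (x - z) (x - y), norm_smul, norm_smul, mul_pow, mul_pow, Real.norm_eq_abs, Real.norm_eq_abs,
    sq_abs, sq_abs, real_inner_smul_left, real_inner_smul_right, real_inner_comm]
  ring

section Geodesics

variable {X : Type*} [MetricSpace X]

namespace IsGeodesicFromTo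

theorem dist_left {c : ℝ → X} {x y : X} (hc : IsGeodesicFromTo c x y) {t : ℝ}
    (ht : t ∈ Icc (0 : ℝ) 1) : dist x (c t) = t * dist x y := by
  have := hc.2.2 0 ⟨le_rfl, zero_le_one⟩ t ht
  rwa [hc.1, zero_sub, abs_neg, abs_of_nonneg ht.1] at this

theorem reverse {c : ℝ → X} {x y : X} (hc : IsGeodesicFromTo c x y) :
    IsGeodesicFromTo (fun t => c (1 - t)) y x := by
  refine ⟨by simp [hc.2.1], by simp [hc.1], fun s hs t ht => ?_⟩
  rw [hc.2.2 _ ⟨by linarith [hs.2], by linarith [hs.1]⟩ _ ⟨by linarith [ht.2], by linarith [ht.1]⟩,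
    dist_comm y x, show 1 - s - (1 - t) = t - s by ring, abs_sub_comm]

theorem smul {G : Type*} [Group G] [MulAction G X] [IsIsometricSMul G X] {c : ℝ → X} {x y : X}
    (hc : IsGeodesicFromTo c x y) (g : G) :
    IsGeodesicFromTo (fun t => g • c t) (g • x) (g • y) := by
  refine ⟨by simp [hc.1], by simp [hc.2.1], fun s hs t ht => ?_⟩
  rw [dist_smul, dist_smul, hc.2.2 s hs t ht]

/-- Affine reparametrisation of an isometrically embedded line. -/
theorem of_isometry {γ : ℝ → X} (hγ : Isometry γ) (a b : ℝ) :
    IsGeodesicFromTo (fun t => γ ((1 - t) * a + t * b)) (γ a) (γ b) := by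
  refine ⟨by simp, by simp, fun s _ t _ => ?_⟩
  rw [hγ.dist_eq, hγ.dist_eq, Real.dist_eq, Real.dist_eq, ← abs_mul,
    ← abs_neg ((s - t) * (a - b))]
  congr 1
  ring

end IsGeodesicFromTo

/-- A ray restricted to an interval is a geodesic. -/
theorem GeodesicRay.isGeodesicFromTo (r : GeodesicRay X) (a b : ℝ≥0) :
    IsGeodesicFromTo (fun t => r.toFun (((1 - t) * a + t * b : ℝ).toNNReal))
      (r.toFun a) (r.toFun b) := by
  refine ⟨by simp, by simp, fun s hs t ht => ?_⟩
  have h : ∀ u ∈ Icc (0 : ℝ) 1, 0 ≤ (1 - u) * (a : ℝ) + u * b := fun u hu =>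
    add_nonneg (mul_nonneg (by linarith [hu.2]) a.2) (mul_nonneg hu.1 b.2)
  rw [r.isometry.dist_eq, r.isometry.dist_eq, NNReal.dist_eq, NNReal.dist_eq,
    Real.coe_toNNReal _ (h s hs), Real.coe_toNNReal _ (h t ht), ← abs_mul,
    ← abs_neg ((s - t) * ((a : ℝ) - b))]
  congr 1
  ring

namespace IsCAT0

/-- The CN inequality of Bruhat and Tits, at an arbitrary point of the side `y z`. -/
theorem dist_sq_le (hX : IsCAT0 X) (x : X) {y z : X} {c : ℝ → X} (hc : IsGeodesicFromTo c y z)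
    {t : ℝ} (ht : t ∈ Icc (0 : ℝ) 1) :
    dist x (c t) ^ 2 ≤
      (1 - t) * dist x y ^ 2 + t * dist x z ^ 2 - t * (1 - t) * dist y z ^ 2 := by
  obtain ⟨d, hd⟩ := hX.exists_geodesic y x
  obtain ⟨y', x', z', h₁, h₂, h₃⟩ := exists_comparison_triangle y x z
  have h := hX.comparison y x z d c hd hc y' x' z' h₁ h₂ h₃ 1 ⟨zero_le_one, le_rfl⟩ t ht
  rw [hd.2.1, AffineMap.lineMap_apply_one] at h
  rw [dist_comm x y, ← h₁, ← h₃, ← h₂, dist_comm y' x', ← dist_lineMap_sq]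
  exact pow_le_pow_left₀ dist_nonneg h 2

theorem dist_mid_sq_le (hX : IsCAT0 X) (x : X) {y z : X} {c : ℝ → X}
    (hc : IsGeodesicFromTo c y z) :
    dist x (c (1 / 2)) ^ 2 ≤ dist x y ^ 2 / 2 + dist x z ^ 2 / 2 - dist y z ^ 2 / 4 := by
  have := hX.dist_sq_le x hc (t := 1 / 2) ⟨by norm_num, by norm_num⟩
  linarith

theorem dist_le_of_common_start (hX : IsCAT0 X) {x y z : X} {c d : ℝ → X}
    (hc : IsGeodesicFromTo c x y) (hd : IsGeodesicFromTo d x z) {t : ℝ}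
    (ht : t ∈ Icc (0 : ℝ) 1) : dist (c t) (d t) ≤ t * dist y z := by
  obtain ⟨x', y', z', h₁, h₂, h₃⟩ := exists_comparison_triangle x y z
  have h := hX.comparison x y z c d hc hd x' y' z' h₁ h₂ h₃ t ht t ht
  rwa [AffineMap.lineMap_apply_module, AffineMap.lineMap_apply_module, dist_add_left, dist_smul₀,
    Real.norm_eq_abs, abs_of_nonneg ht.1, h₃] at h

/-- Convexity of the metric. -/
theorem dist_le (hX : IsCAT0 X) {x y x' y' : X} {c d : ℝ → X}
    (hc : IsGeodesicFromTo c x y) (hd : IsGeodesicFromTo d x' y') {t : ℝ}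
    (ht : t ∈ Icc (0 : ℝ) 1) : dist (c t) (d t) ≤ (1 - t) * dist x x' + t * dist y y' := by
  -- A diagonal cuts the quadrilateral into two triangles, each with two sides issuing from one
  -- vertex.
  obtain ⟨e, he⟩ := hX.exists_geodesic x y'
  have h₁ := hX.dist_le_of_common_start hc he ht
  have h₂ := hX.dist_le_of_common_start he.reverse hd.reverse (t := 1 - t)
    ⟨by linarith [ht.2], by linarith [ht.1]⟩
  simp only [sub_sub_cancel] at h₂
  linarith [dist_triangle (c t) (e t) (d t)]

/-- Apply the CN inequality at `y` and at `q` to the midpoint of the diagonal `x p`, then the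
triangle inequality through that midpoint. -/
theorem dist_sq_add_dist_sq_le (hX : IsCAT0 X) (x y p q : X) :
    dist x p ^ 2 + dist y q ^ 2 ≤
      dist x y ^ 2 + dist y p ^ 2 + dist p q ^ 2 + dist q x ^ 2 := by
  obtain ⟨c, hc⟩ := hX.exists_geodesic x p
  have h₁ := hX.dist_mid_sq_le y hc
  have h₂ := hX.dist_mid_sq_le q hc
  have h₃ := dist_triangle_right y q (c (1 / 2))
  rw [dist_comm y x] at h₁
  rw [dist_comm q p] at h₂
  nlinarith [sq_nonneg (dist y (c (1 / 2)) - dist q (c (1 / 2))),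
    pow_le_pow_left₀ dist_nonneg h₃ 2]

end IsCAT0

/-! ### Convex and affine functions on geodesic spaces -/

/-- Convexity of a function along all geodesics. -/
def GeodesicallyConvexFun (f : X → ℝ) : Prop :=
  ∀ ⦃x y : X⦄ ⦃c : ℝ → X⦄, IsGeodesicFromTo c x y → ∀ t ∈ Icc (0 : ℝ) 1,
    f (c t) ≤ (1 - t) * f x + t * f y

/-- Affinity of a function along all geodesics. -/
def GeodesicallyAffineFun (f : X → ℝ) : Prop :=
  ∀ ⦃x y : X⦄ ⦃c : ℝ → X⦄, IsGeodesicFromTo c x y → ∀ t ∈ Icc (0 : ℝ) 1,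
    f (c t) = (1 - t) * f x + t * f y

/-- `f` is invariant up to additive constants. -/
def QuasiInvariant (G : Type*) [SMul G X] (f : X → ℝ) : Prop :=
  ∀ g : G, ∃ a : ℝ, ∀ x : X, f (g • x) = f x + a

theorem GeodesicallyConvexFun.isGeodesicallyConvex_sublevel {f : X → ℝ}
    (hf : GeodesicallyConvexFun f) (r : ℝ) : IsGeodesicallyConvex {x | f x ≤ r} := by
  intro x hx y hy c hc t ht
  have := hf hc t ht
  simp only [mem_ofPred_eq] at hx hy ⊢
  nlinarith [ht.1, ht.2]

theorem GeodesicallyConvexFun.max_const {f : X → ℝ} (hf : GeodesicallyConvexFun f) (r : ℝ) :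
    GeodesicallyConvexFun fun x => max (f x) r := by
  intro x y c hc t ht
  have h₁ := hf hc t ht
  have h₂ := mul_le_mul_of_nonneg_left (le_max_left (f x) r) (sub_nonneg.2 ht.2)
  have h₃ := mul_le_mul_of_nonneg_left (le_max_left (f y) r) ht.1
  have h₄ := mul_le_mul_of_nonneg_left (le_max_right (f x) r) (sub_nonneg.2 ht.2)
  have h₅ := mul_le_mul_of_nonneg_left (le_max_right (f y) r) ht.1
  exact max_le (by linarith) (by linarith)

/-- The distance function to a convex set is convex. -/
theorem IsCAT0.convex_infDist (hX : IsCAT0 X) {C : Set X} (hne : C.Nonempty)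
    (hC : IsGeodesicallyConvex C) : GeodesicallyConvexFun fun x => Metric.infDist x C := by
  intro x y c hc t ht
  refine le_of_forall_pos_le_add fun ε hε => ?_
  obtain ⟨p, hp, hxp⟩ := (Metric.infDist_lt_iff hne).1 (lt_add_of_pos_right (Metric.infDist x C) hε)
  obtain ⟨q, hq, hyq⟩ := (Metric.infDist_lt_iff hne).1 (lt_add_of_pos_right (Metric.infDist y C) hε)
  obtain ⟨d, hd⟩ := hX.exists_geodesic p q
  have h₁ := Metric.infDist_le_dist_of_mem (x := c t) (hC p hp q hq d hd t ht)
  have h₂ := hX.dist_le hc hd ht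
  have h₃ := mul_le_mul_of_nonneg_left hxp.le (sub_nonneg.2 ht.2)
  have h₄ := mul_le_mul_of_nonneg_left hyq.le ht.1
  linarith

end Geodesics

/-! ### Rays of steepest descent of a convex function -/

section SteepestRays

open Filter Topology

variable {X : Type*} [MetricSpace X]

/-- By convexity, the drop at rate `s` at a far endpoint is inherited by the whole geodesic from
`o`. Properness yields a limit ray as the endpoints recede. -/
theorem IsCAT0.exists_steep_ray [ProperSpace X] (hX : IsCAT0 X) {f : X → ℝ} {K : ℝ≥0}
    (hK : LipschitzWith K f) (hf : GeodesicallyConvexFun f) (o : X) {s : ℝ} (hs : 0 < s)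
    (hsteep : ∀ t : ℝ, 0 ≤ t → ∃ z, dist o z ≤ t ∧ s * t ≤ f o - f z) :
    ∃ r : GeodesicRay X, ∀ u : ℝ≥0, f (r.toFun u) ≤ f o - s * u := by
  choose z hz₁ hz₂ using fun n : ℕ => hsteep n n.cast_nonneg
  choose c hc using fun n => hX.exists_geodesic o (z n)
  set d : ℕ → ℝ := fun n => dist o (z n) with hd
  have hd0 : ∀ n, 0 ≤ d n := fun n => dist_nonneg
  have hsd : ∀ n, s * n ≤ (K + 1) * d n := fun n => by
    have := (le_abs_self _).trans (hK.dist_le_mul o (z n))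
    nlinarith [hz₂ n, hd0 n]
  -- A non-principal ultrafilter gives limits at all times `u` at once, with no diagonal
  -- subsequence.
  have hlarge : ∀ u : ℝ, ∀ᶠ n : ℕ in hyperfilter ℕ, u < d n := fun u => by
    have h₁ : Tendsto (fun n : ℕ => s * (n : ℝ)) atTop atTop :=
      tendsto_natCast_atTop_atTop.const_mul_atTop hs
    have h₂ := h₁.eventually (eventually_gt_atTop ((K + 1) * u))
    rw [← Nat.cofinite_eq_atTop] at h₂
    refine (h₂.filter_mono hyperfilter_le_cofinite).mono fun n hn => ?_
    have hK1 : (0 : ℝ) < K + 1 := by positivity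
    exact lt_of_mul_lt_mul_left (hn.trans_le (hsd n)) hK1.le
  have hmem : ∀ (n : ℕ) (u : ℝ≥0), min (u / d n) 1 ∈ Icc (0 : ℝ) 1 := fun n u =>
    ⟨le_min (div_nonneg u.2 (hd0 n)) zero_le_one, min_le_right _ _⟩
  let p : ℕ → ℝ≥0 → X := fun n u => c n (min (u / d n) 1)
  have hball : ∀ (n : ℕ) (u : ℝ≥0), p n u ∈ Metric.closedBall o u := fun n u => by
    rw [Metric.mem_closedBall, dist_comm, (hc n).dist_left (hmem n u)]
    refine (mul_le_mul_of_nonneg_right (min_le_left _ _) (hd0 n)).trans ?_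
    rcases (hd0 n).eq_or_lt with h | h
    · simp [← h]
    · exact (div_mul_cancel₀ _ h.ne').le
  have hlim : ∀ u : ℝ≥0, ∃ y, Tendsto (fun n => p n u) (hyperfilter ℕ) (𝓝 y) := fun u => by
    obtain ⟨y, -, hy⟩ := (isCompact_closedBall o (u : ℝ)).ultrafilter_le_nhds'
      ((hyperfilter ℕ).map fun n => p n u)
      (Ultrafilter.mem_map.2 (Filter.univ_mem' fun n => hball n u))
    exact ⟨y, hy⟩
  choose ρ hρ using hlim
  have hpar : ∀ u : ℝ≥0, ∀ᶠ n : ℕ in hyperfilter ℕ, min (u / d n) 1 = u / d n ∧ 0 < d n :=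
    fun u => (hlarge u).mono fun n hn => by
      have : 0 < d n := u.2.trans_lt hn
      exact ⟨min_eq_left ((div_le_one this).2 hn.le), this⟩
  refine ⟨⟨ρ, Isometry.of_dist_eq fun u v => ?_⟩, fun u => ?_⟩
  · refine tendsto_nhds_unique ((hρ u).dist (hρ v)) (tendsto_const_nhds.congr' ?_)
    filter_upwards [hpar u, hpar v] with n hu hv
    rw [(hc n).2.2 _ (hmem n u) _ (hmem n v), hu.1, hv.1, ← sub_div, abs_div, abs_of_pos hu.2,
      NNReal.dist_eq, div_mul_cancel₀ _ hu.2.ne']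
  · refine le_of_tendsto ((hK.continuous.tendsto _).comp (hρ u)) ?_
    filter_upwards [hpar u] with n hu
    have h₁ := hf (hc n) _ (hmem n u)
    simp only [Function.comp, p]
    rw [hu.1] at h₁ ⊢
    have h₂ : s * u ≤ u / d n * (f o - f (z n)) := by
      have h₃ : s * d n ≤ f o - f (z n) :=
        (mul_le_mul_of_nonneg_left (hz₁ n) hs.le).trans (hz₂ n)
      calc s * u = u / d n * (s * d n) := by field_simp [hu.2.ne']
        _ ≤ _ := mul_le_mul_of_nonneg_left h₃ (div_nonneg u.2 hu.2.le)
    linarith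

theorem IsCAT0.dist_ray_convex (hX : IsCAT0 X) (r r' : GeodesicRay X) {v u : ℝ≥0} (hu : 0 < u)
    (hvu : v ≤ u) : dist (r.toFun v) (r'.toFun v) ≤
      dist (r.toFun 0) (r'.toFun 0) + v / u * dist (r.toFun u) (r'.toFun u) := by
  have hu' : (0 : ℝ) < u := hu
  have ht : (v / u : ℝ) ∈ Icc (0 : ℝ) 1 :=
    ⟨by positivity, (div_le_one hu').2 (NNReal.coe_le_coe.2 hvu)⟩
  have h := hX.dist_le (r.isGeodesicFromTo 0 u) (r'.isGeodesicFromTo 0 u) ht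
  have h₁ : (v / u : ℝ) * u = v := div_mul_cancel₀ _ hu'.ne'
  simp only [NNReal.coe_zero, mul_zero, zero_add, h₁, Real.toNNReal_coe] at h
  nlinarith [ht.1, dist_nonneg (x := r.toFun 0) (y := r'.toFun 0)]

/-- If the rays diverged linearly, the CN inequality would put the midpoint of their points at time
`u` nearer to `o` than `u` by a definite factor, while convexity keeps the drop of `f` there at
about `s * u`. The slope would exceed the maximal one. Sublinear divergence is bounded, by convexity
of the distance. -/
theorem IsCAT0.asymptotic_of_steepest (hX : IsCAT0 X) {f : X → ℝ}
    (hf : GeodesicallyConvexFun f) (o : X) {s : ℝ} (hs : 0 < s)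
    (hmax : ∀ σ > s, ∃ t₀ > 0, ∀ t ≥ t₀, ∀ z, dist o z ≤ t → f o - f z < σ * t)
    (r r' : GeodesicRay X) (C : ℝ) (hr : ∀ u : ℝ≥0, f (r.toFun u) ≤ C - s * u)
    (hr' : ∀ u : ℝ≥0, f (r'.toFun u) ≤ C - s * u) : r.Asymptotic r' := by
  refine ⟨dist (r.toFun 0) (r'.toFun 0), fun v => ?_⟩
  set K := max (dist o (r.toFun 0)) (dist o (r'.toFun 0)) with hK
  have hK0 : 0 ≤ K := dist_nonneg.trans (le_max_left _ _)
  have hdist : ∀ u : ℝ≥0, dist o (r.toFun u) ≤ u + K := fun u => by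
    have h₁ := dist_triangle o (r.toFun 0) (r.toFun u)
    rw [r.isometry.dist_eq, NNReal.dist_eq, NNReal.coe_zero, zero_sub, abs_neg, NNReal.abs_eq] at h₁
    linarith [le_max_left (dist o (r.toFun 0)) (dist o (r'.toFun 0))]
  have hdist' : ∀ u : ℝ≥0, dist o (r'.toFun u) ≤ u + K := fun u => by
    have h₁ := dist_triangle o (r'.toFun 0) (r'.toFun u)
    rw [r'.isometry.dist_eq, NNReal.dist_eq, NNReal.coe_zero, zero_sub, abs_neg,
      NNReal.abs_eq] at h₁
    linarith [le_max_right (dist o (r.toFun 0)) (dist o (r'.toFun 0))]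
  have key : ∀ ε : ℝ, 0 < ε → ∃ u : ℝ≥0, 0 < u ∧ v ≤ u ∧
      dist (r.toFun u) (r'.toFun u) ≤ ε * u := by
    intro ε hε
    by_contra! hcon
    have hσ : ∀ σ > s, s ^ 2 ≤ σ ^ 2 * (1 - ε ^ 2 / 4) := by
      intro σ hσs
      have hσ0 : 0 < σ := hs.trans hσs
      obtain ⟨t₀, ht₀, ht⟩ := hmax σ hσs
      have hev : ∀ᶠ u : ℝ in atTop, (s - (C - f o) * u⁻¹) ^ 2 ≤
          σ ^ 2 * ((1 + K * u⁻¹) ^ 2 - ε ^ 2 / 4) := by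
        have hlin : Tendsto (fun u : ℝ => s * u) atTop atTop :=
          tendsto_id.const_mul_atTop hs
        filter_upwards [eventually_gt_atTop 0, eventually_ge_atTop (v : ℝ),
          hlin.eventually (eventually_ge_atTop (σ * t₀ + (C - f o)))] with u hu0 huv hul
        lift u to ℝ≥0 using hu0.le
        have hδ := hcon u (by exact_mod_cast hu0) (by exact_mod_cast huv)
        obtain ⟨c, hc⟩ := hX.exists_geodesic (r.toFun u) (r'.toFun u)
        have h₁ := hf hc (1 / 2) ⟨by norm_num, by norm_num⟩
        have h₂ := hX.dist_mid_sq_le o hc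
        have h₃ := pow_le_pow_left₀ dist_nonneg (hdist u) 2
        have h₄ := pow_le_pow_left₀ dist_nonneg (hdist' u) 2
        have h₅ := pow_le_pow_left₀ (by positivity) hδ.le 2
        -- The slope bound holds only for radii at least `t₀`; the choice of large `u` then rules
        -- out that the maximum is `t₀`.
        have h₆ := ht (max (dist o (c (1 / 2))) t₀) (le_max_right _ _) _ (le_max_left _ _)
        have h₇ : s * u - (C - f o) < σ * max (dist o (c (1 / 2))) t₀ := by
          linarith [hr u, hr' u]
        have h₈ : s * u - (C - f o) < σ * dist o (c (1 / 2)) := by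
          rcases le_total (dist o (c (1 / 2))) t₀ with h | h
          · rw [max_eq_right h] at h₇
            linarith
          · rwa [max_eq_left h] at h₇
        have h₉ : (s * u - (C - f o)) ^ 2 ≤ (σ * dist o (c (1 / 2))) ^ 2 :=
          pow_le_pow_left₀ (by nlinarith) h₈.le 2
        have h₁₀ : (s * u - (C - f o)) ^ 2 ≤ σ ^ 2 * ((u + K) ^ 2 - (ε * u) ^ 2 / 4) := by
          rw [mul_pow] at h₉
          refine h₉.trans (mul_le_mul_of_nonneg_left ?_ (sq_nonneg σ))
          linarith
        have hu2 : (0 : ℝ) < (u : ℝ) ^ 2 := by positivity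
        have e₁ : (s - (C - f o) * (u : ℝ)⁻¹) ^ 2 = (s * u - (C - f o)) ^ 2 / (u : ℝ) ^ 2 := by
          field_simp
        have e₂ : σ ^ 2 * ((1 + K * (u : ℝ)⁻¹) ^ 2 - ε ^ 2 / 4) =
            σ ^ 2 * ((u + K) ^ 2 - (ε * u) ^ 2 / 4) / (u : ℝ) ^ 2 := by
          field_simp
        rw [e₁, e₂]
        gcongr
      have l₀ := tendsto_inv_atTop_zero (𝕜 := ℝ)
      have l₁ := (tendsto_const_nhds (x := s)).sub (l₀.const_mul (C - f o)) |>.pow 2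
      have l₂ := (((tendsto_const_nhds (x := (1 : ℝ))).add (l₀.const_mul K)).pow 2
        |>.sub (tendsto_const_nhds (x := ε ^ 2 / 4))).const_mul (σ ^ 2)
      have := le_of_tendsto_of_tendsto l₁ l₂ hev
      simpa using this
    have hcont : Tendsto (fun σ : ℝ => σ ^ 2 * (1 - ε ^ 2 / 4)) (𝓝[>] s)
        -- Letting `σ` decrease to `s` gives `s ^ 2 ≤ s ^ 2 * (1 - ε ^ 2 / 4)`, absurd.
        (𝓝 (s ^ 2 * (1 - ε ^ 2 / 4))) :=
      ((continuous_id.pow 2).mul continuous_const).continuousWithinAt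
    have := ge_of_tendsto hcont (eventually_mem_of_tendsto_nhdsWithin tendsto_id |>.mono hσ)
    have : 0 < s ^ 2 * ε ^ 2 := by positivity
    linarith
  refine le_of_forall_pos_le_add fun ε hε => ?_
  obtain ⟨u, hu, hvu, h⟩ := key (ε / (v + 1)) (by positivity)
  have hu' : (0 : ℝ) < u := hu
  refine (hX.dist_ray_convex r r' hu hvu).trans (add_le_add_right ?_ _)
  calc (v / u : ℝ) * dist (r.toFun u) (r'.toFun u) ≤ v / u * (ε / (v + 1) * u) := by gcongr
    _ = ε * (v / (v + 1)) := by field_simp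
    _ ≤ ε * 1 := by
      gcongr
      exact (div_le_one (by positivity)).2 (by linarith)
    _ = ε := mul_one ε

/-- The supremum of the admissible slopes is itself admissible because `f` attains its minimum on
each ball. A slope that fails at one radius fails at every larger one, by convexity along geodesics
from `o`. -/
theorem IsCAT0.exists_steepest_slope [ProperSpace X] (hX : IsCAT0 X) {f : X → ℝ} {K : ℝ≥0}
    (hK : LipschitzWith K f) (hf : GeodesicallyConvexFun f) (o : X) {σ₀ : ℝ}
    (hσ₀ : ∀ t : ℝ, 0 ≤ t → ∃ z, dist o z ≤ t ∧ σ₀ * t ≤ f o - f z) :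
    ∃ s ≥ σ₀, (∀ t : ℝ, 0 ≤ t → ∃ z, dist o z ≤ t ∧ s * t ≤ f o - f z) ∧
      ∀ σ > s, ∃ t₀ > 0, ∀ t ≥ t₀, ∀ z, dist o z ≤ t → f o - f z < σ * t := by
  set A : Set ℝ := {σ | ∀ t : ℝ, 0 ≤ t → ∃ z, dist o z ≤ t ∧ σ * t ≤ f o - f z} with hA
  have hbdd : BddAbove A := ⟨K, fun σ hσ => by
    obtain ⟨z, hz₁, hz₂⟩ := hσ 1 zero_le_one
    have h₁ := (le_abs_self _).trans (hK.dist_le_mul o z)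
    have h₂ := mul_le_mul_of_nonneg_left hz₁ K.coe_nonneg
    linarith⟩
  refine ⟨sSup A, le_csSup hbdd hσ₀, fun t ht => ?_, fun σ hσ => ?_⟩
  · obtain ⟨z, hz, hzmax⟩ := (isCompact_closedBall o t).exists_isMaxOn
      ⟨o, Metric.mem_closedBall_self ht⟩
      ((continuous_const (y := f o)).sub hK.continuous).continuousOn
    refine ⟨z, by rwa [Metric.mem_closedBall, dist_comm] at hz, ?_⟩
    rcases ht.eq_or_lt with rfl | ht
    · have := hzmax (Metric.mem_closedBall_self le_rfl)
      simp at this ⊢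
      exact this
    rw [← le_div_iff₀ ht]
    refine csSup_le ⟨σ₀, hσ₀⟩ fun σ hσ => ?_
    obtain ⟨w, hw₁, hw₂⟩ := hσ t ht.le
    rw [le_div_iff₀ ht]
    exact hw₂.trans (hzmax (by rwa [Metric.mem_closedBall, dist_comm]))
  · have : σ ∉ A := fun h => (le_csSup hbdd h).not_gt hσ
    simp only [hA, mem_ofPred_eq, not_forall, not_exists, not_and, not_le] at this
    obtain ⟨t₀, ht₀, hlt⟩ := this
    have ht₀' : 0 < t₀ := ht₀.lt_of_ne fun h => by
      subst h
      have := hlt o (dist_self o).le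
      simp at this
    refine ⟨t₀, ht₀', fun t ht z hz => ?_⟩
    by_contra! hcon
    have ht' : 0 < t := ht₀'.trans_le ht
    obtain ⟨c, hc⟩ := hX.exists_geodesic o z
    have hmem : t₀ / t ∈ Icc (0 : ℝ) 1 := ⟨by positivity, (div_le_one ht').2 ht⟩
    have h₁ := hf hc _ hmem
    have h₂ : dist o (c (t₀ / t)) ≤ t₀ := by
      rw [hc.dist_left hmem]
      calc t₀ / t * dist o z ≤ t₀ / t * t := mul_le_mul_of_nonneg_left hz hmem.1
        _ = t₀ := div_mul_cancel₀ _ ht'.ne'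
    have h₃ := hlt _ h₂
    have h₄ : σ * t₀ ≤ t₀ / t * (f o - f z) := by
      calc σ * t₀ = t₀ / t * (σ * t) := by field_simp
        _ ≤ _ := mul_le_mul_of_nonneg_left hcon hmem.1
    linarith

end SteepestRays

/-- A non-zero additive constant makes `f` drop linearly along the orbit of some `k`, so a steepest
ray exists. Its translates descend at the same slope up to a constant, hence are asymptotic to it,
and its endpoint is fixed. -/
theorem NoFixedPointAtInfinity.invariant_of_quasiInvariant {G X : Type*} [Group G]
    [MetricSpace X] [ProperSpace X] [MulAction G X] [IsIsometricSMul G X] (hX : IsCAT0 X)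
    (hfix : NoFixedPointAtInfinity G X) {f : X → ℝ} {K : ℝ≥0} (hK : LipschitzWith K f)
    (hf : GeodesicallyConvexFun f) (hG : QuasiInvariant G f) (g : G) (x : X) :
    f (g • x) = f x := by
  choose χ hχ using hG
  suffices χ g = 0 by rw [hχ, this, add_zero]
  by_contra hne
  obtain ⟨k, hk⟩ : ∃ k : G, χ k < 0 := by
    rcases lt_or_gt_of_ne hne with h | h
    · exact ⟨g, h⟩
    · refine ⟨g⁻¹, ?_⟩
      have h₁ := hχ g (g⁻¹ • x)
      have h₂ := hχ g⁻¹ x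
      rw [smul_inv_smul] at h₁
      linarith
  have hpow : ∀ n : ℕ, f (k ^ n • x) = f x + n * χ k := fun n => by
    induction n with
    | zero => simp
    | succ n ih =>
      rw [pow_succ', mul_smul, hχ, ih]
      push_cast
      ring
  have hD : 0 < dist x (k • x) := dist_pos.2 fun h => by
    have := hχ k x
    rw [← h] at this
    linarith
  have hdist : ∀ n : ℕ, dist x (k ^ n • x) ≤ n * dist x (k • x) := fun n => by
    induction n with
    | zero => simp
    | succ n ih =>
      have h₁ := dist_triangle x (k ^ n • x) (k ^ (n + 1) • x)
      rw [pow_succ, mul_smul, dist_smul] at h₁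
      rw [pow_succ, mul_smul]
      push_cast
      linarith
  obtain ⟨s, hs, hsteep, hmax⟩ := hX.exists_steepest_slope hK hf x
    -- The drop per step of the orbit `k ^ n • x`, divided by the step length. For radius `t`, stop
    -- part-way along the geodesic to an orbit point with `t < n * dist x (k • x)`.
    (σ₀ := -χ k / dist x (k • x)) fun t ht => by
      obtain ⟨n, hn⟩ := exists_nat_gt (t / dist x (k • x))
      rw [div_lt_iff₀ hD] at hn
      have hnD : 0 < n * dist x (k • x) := ht.trans_lt hn
      obtain ⟨c, hc⟩ := hX.exists_geodesic x (k ^ n • x)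
      have hmem : t / (n * dist x (k • x)) ∈ Icc (0 : ℝ) 1 :=
        ⟨by positivity, (div_le_one hnD).2 hn.le⟩
      refine ⟨c (t / (n * dist x (k • x))), ?_, ?_⟩
      · rw [hc.dist_left hmem]
        calc _ ≤ t / (n * dist x (k • x)) * (n * dist x (k • x)) :=
              mul_le_mul_of_nonneg_left (hdist n) hmem.1
          _ = t := div_mul_cancel₀ _ hnD.ne'
      · have h₁ := hf hc _ hmem
        rw [hpow] at h₁
        have hn0 : (n : ℝ) ≠ 0 := by
          rintro h
          simp [h] at hnD
        have h₂ : -χ k / dist x (k • x) * t = t / (n * dist x (k • x)) * (n * -χ k) := by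
          field_simp
        linarith
  have hs0 : 0 < s := (div_pos (neg_pos.2 hk) hD).trans_le hs
  obtain ⟨r, hr⟩ := hX.exists_steep_ray hK hf x hs0 hsteep
  refine hfix ⟨Quotient.mk _ r, fun g => Quotient.sound ?_⟩
  refine hX.asymptotic_of_steepest hf x hs0 hmax _ _ (f x + |χ g|) (fun u => ?_) fun u => ?_
  · change f (g • r.toFun u) ≤ _
    rw [hχ]
    linarith [hr u, le_abs_self (χ g)]
  · linarith [hr u, abs_nonneg (χ g)]

/-- If `G` acts minimally, without fixed point at infinity, then all Lipschitz convex functions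
which `G` preserves up to constants are constant. -/
theorem ActsMinimally.eq_of_quasiInvariant {G X : Type*} [Group G]
    [MetricSpace X] [ProperSpace X] [MulAction G X] [IsIsometricSMul G X] (hX : IsCAT0 X)
    (hmin : ActsMinimally G X) (hfix : NoFixedPointAtInfinity G X) {f : X → ℝ} {K : ℝ≥0}
    (hK : LipschitzWith K f) (hf : GeodesicallyConvexFun f) (hG : QuasiInvariant G f) (x y : X) :
    f x = f y := by
  have key : ∀ x y, f y ≤ f x := fun x y => by
    have := hmin {z | f z ≤ f x} ⟨x, by simp⟩ (isClosed_le hK.continuous continuous_const)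
      (hf.isGeodesicallyConvex_sublevel _) fun g z hz => by
        rw [mem_ofPred_eq, hfix.invariant_of_quasiInvariant hX hK hf hG]
        exact hz
    exact this.ge (mem_univ y)
  exact le_antisymm (key y x) (key x y)

/-! ### Averaging over the quotient, and minimality of the subgroup -/

section Averaging

variable {G X : Type*} [Group G] [TopologicalSpace G] [IsTopologicalGroup G]
  [MetricSpace X] [MulAction G X] [IsIsometricSMul G X] [ContinuousSMul G X]

/-- A function on `X` which a subgroup `H` preserves up to constants gives, for each pair of points
of `X`, a function on `G ⧸ H`: the differences of the values of the translates. -/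
def QuasiInvariant.translateDiff {H : Subgroup G} {f : X → ℝ} (hf : QuasiInvariant H f) (o x : X) :
    G ⧸ H → ℝ :=
  Quotient.lift (fun g : G => f (g⁻¹ • x) - f (g⁻¹ • o)) fun a b hab => by
    have hab' : a⁻¹ * b ∈ H := QuotientGroup.leftRel_apply.1 hab
    obtain ⟨k, hk⟩ := hf ⟨b⁻¹ * a, by simpa using H.inv_mem hab'⟩
    have h : ∀ z, f (b⁻¹ • z) = f (a⁻¹ • z) + k := fun z => by
      rw [← hk, Subgroup.mk_smul, mul_smul, smul_inv_smul]
    simp only [h]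
    ring

namespace QuasiInvariant

variable {H : Subgroup G} {f : X → ℝ}

omit [TopologicalSpace G] [IsTopologicalGroup G] [MetricSpace X] [IsIsometricSMul G X]
  [ContinuousSMul G X] in
theorem translateDiff_mk (hf : QuasiInvariant H f) (o x : X) (g : G) :
    hf.translateDiff o x (g : G ⧸ H) = f (g⁻¹ • x) - f (g⁻¹ • o) := rfl

omit [IsIsometricSMul G X] in
theorem continuous_translateDiff (hf : QuasiInvariant H f) (hc : Continuous f) (o x : X) :
    Continuous (hf.translateDiff o x) := by
  refine Continuous.quotient_lift ?_ _
  fun_prop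

theorem abs_translateDiff_sub_le (hf : QuasiInvariant H f) {K : ℝ≥0} (hK : LipschitzWith K f)
    (o x y : X) (q : G ⧸ H) :
    |hf.translateDiff o x q - hf.translateDiff o y q| ≤ K * dist x y := by
  induction q using QuotientGroup.induction_on with
  | H g =>
    have := hK.dist_le_mul (g⁻¹ • x) (g⁻¹ • y)
    rw [dist_smul, Real.dist_eq] at this
    rwa [translateDiff_mk, translateDiff_mk, sub_sub_sub_cancel_right]

theorem abs_translateDiff_le (hf : QuasiInvariant H f) {K : ℝ≥0} (hK : LipschitzWith K f)
    (o x : X) (q : G ⧸ H) : |hf.translateDiff o x q| ≤ K * dist x o := by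
  have h := hf.abs_translateDiff_sub_le hK o x o q
  have h₀ : hf.translateDiff o o q = 0 := by
    induction q using QuotientGroup.induction_on with
    | H g => rw [translateDiff_mk, sub_self]
  rwa [h₀, sub_zero] at h

omit [TopologicalSpace G] [IsTopologicalGroup G] [ContinuousSMul G X] in
theorem translateDiff_le (hf : QuasiInvariant H f) (hconv : GeodesicallyConvexFun f) (o : X)
    {x y : X} {c : ℝ → X} (hc : IsGeodesicFromTo c x y) {t : ℝ} (ht : t ∈ Icc (0 : ℝ) 1)
    (q : G ⧸ H) : hf.translateDiff o (c t) q ≤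
      (1 - t) * hf.translateDiff o x q + t * hf.translateDiff o y q := by
  induction q using QuotientGroup.induction_on with
  | H g =>
    have := hconv (hc.smul g⁻¹) t ht
    simp only [translateDiff_mk]
    linarith

variable [MeasurableSpace (G ⧸ H)] [BorelSpace (G ⧸ H)] (μ : Measure (G ⧸ H)) [IsFiniteMeasure μ]

theorem integrable_translateDiff (hf : QuasiInvariant H f) {K : ℝ≥0} (hK : LipschitzWith K f)
    (o x : X) : Integrable (hf.translateDiff o x) μ :=
  Integrable.of_bound (hf.continuous_translateDiff hK.continuous o x).measurable.aestronglyMeasurable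
    (K * dist x o) (.of_forall fun q => hf.abs_translateDiff_le hK o x q)

theorem lipschitzWith_integral_translateDiff (hf : QuasiInvariant H f) {K : ℝ≥0}
    (hK : LipschitzWith K f) (o : X) :
    LipschitzWith (K * (μ.real univ).toNNReal) fun x => ∫ q, hf.translateDiff o x q ∂μ := by
  refine LipschitzWith.of_dist_le_mul fun x y => ?_
  rw [Real.dist_eq, ← integral_sub (hf.integrable_translateDiff μ hK o x)
    (hf.integrable_translateDiff μ hK o y)]
  have := norm_integral_le_of_norm_le_const (μ := μ) (C := K * dist x y)
    (f := fun q => hf.translateDiff o x q - hf.translateDiff o y q)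
    (.of_forall fun q => hf.abs_translateDiff_sub_le hK o x y q)
  rw [Real.norm_eq_abs] at this
  refine this.trans_eq ?_
  rw [NNReal.coe_mul, Real.coe_toNNReal _ measureReal_nonneg]
  ring

theorem convex_integral_translateDiff (hf : QuasiInvariant H f) {K : ℝ≥0}
    (hK : LipschitzWith K f) (hconv : GeodesicallyConvexFun f) (o : X) :
    GeodesicallyConvexFun fun x => ∫ q, hf.translateDiff o x q ∂μ := by
  intro x y c hc t ht
  have hi := hf.integrable_translateDiff μ hK o
  simp only
  rw [← integral_const_mul, ← integral_const_mul,
    ← integral_add ((hi x).const_mul _) ((hi y).const_mul _)]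
  exact integral_mono (hi _) (((hi x).const_mul _).add ((hi y).const_mul _))
    fun q => hf.translateDiff_le hconv o hc ht q

/-- By invariance of the measure, moving `x` by `g` amounts to moving the base point to `g⁻¹ • o`,
which costs a term independent of `x`. -/
theorem quasiInvariant_integral_translateDiff (hf : QuasiInvariant H f) {K : ℝ≥0}
    (hK : LipschitzWith K f) (o : X) [SMulInvariantMeasure G (G ⧸ H) μ] :
    QuasiInvariant G fun x => ∫ q, hf.translateDiff o x q ∂μ := by
  intro g
  refine ⟨-∫ q, hf.translateDiff o (g⁻¹ • o) q ∂μ, fun x => ?_⟩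
  have hi := hf.integrable_translateDiff μ hK o
  simp only
  rw [← sub_eq_add_neg, ← integral_sub (hi _) (hi _),
    ← integral_smul_eq_self (μ := μ) (fun q => hf.translateDiff o (g • x) q) (g := g)]
  congr 1
  ext q
  induction q using QuotientGroup.induction_on with
  | H k =>
    have : g • (k : G ⧸ H) = ((g * k : G) : G ⧸ H) := rfl
    rw [this, translateDiff_mk, translateDiff_mk, translateDiff_mk]
    simp [mul_smul]

end QuasiInvariant

/-- A convex function on `[0, 1]` with the right value at `1 / 2` is affine. -/
theorem GeodesicallyConvexFun.affine_of_midpoint {f : X → ℝ} (hf : GeodesicallyConvexFun f)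
    (hmid : ∀ ⦃x y : X⦄ ⦃c : ℝ → X⦄, IsGeodesicFromTo c x y →
      f (c (1 / 2)) = f x / 2 + f y / 2) : GeodesicallyAffineFun f := by
  have key : ∀ ⦃x y : X⦄ ⦃c : ℝ → X⦄, IsGeodesicFromTo c x y → ∀ t ∈ Icc (0 : ℝ) (1 / 2),
      (1 - t) * f x + t * f y ≤ f (c t) := by
    intro x y c hc t ht
    have ht1 : t ∈ Icc (0 : ℝ) 1 := ⟨ht.1, by linarith [ht.2]⟩
    -- The midpoint of `c` lies between `c t` and `y`, so convexity there bounds `f (c t)` from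
    -- below.
    have hd : IsGeodesicFromTo (fun u => c ((1 - u) * t + u * 1)) (c t) y := by
      refine ⟨by simp, by simp [hc.2.1], fun u hu v hv => ?_⟩
      have hmem : ∀ u ∈ Icc (0 : ℝ) 1, (1 - u) * t + u * 1 ∈ Icc (0 : ℝ) 1 := fun u hu =>
        ⟨by nlinarith [hu.1, hu.2, ht.1], by nlinarith [hu.1, hu.2, ht1.2]⟩
      have h₁ := hc.2.2 t ht1 1 ⟨zero_le_one, le_rfl⟩
      rw [hc.2.1] at h₁
      rw [hc.2.2 _ (hmem u hu) _ (hmem v hv), h₁, ← mul_assoc, abs_sub_comm t 1,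
        ← abs_mul]
      congr 2
      ring
    have h1t : 0 < 1 - t := by linarith [ht.2]
    have hu : (1 / 2 - t) / (1 - t) ∈ Icc (0 : ℝ) 1 :=
      ⟨div_nonneg (by linarith [ht.2]) h1t.le, (div_le_one h1t).2 (by linarith)⟩
    have h := hf hd _ hu
    have e : (1 - (1 / 2 - t) / (1 - t)) * t + (1 / 2 - t) / (1 - t) * 1 = 1 / 2 := by
      field_simp
      ring
    simp only [e] at h
    rw [hmid hc] at h
    have e₁ : 1 - (1 / 2 - t) / (1 - t) = 1 / 2 / (1 - t) := by
      field_simp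
      ring
    rw [e₁] at h
    have h' := mul_le_mul_of_nonneg_left h h1t.le
    have e₂ : (1 - t) * (1 / 2 / (1 - t) * f (c t) + (1 / 2 - t) / (1 - t) * f y) =
        f (c t) / 2 + (1 / 2 - t) * f y := by
      field_simp
    rw [e₂] at h'
    linarith
  intro x y c hc t ht
  refine le_antisymm (hf hc t ht) ?_
  rcases le_total t (1 / 2) with h | h
  · exact key hc t ⟨ht.1, h⟩
  · have := key hc.reverse (1 - t) ⟨by linarith [ht.2], by linarith⟩
    simp only [sub_sub_cancel] at this
    linarith

/-- If `G ⧸ H` has finite invariant measure, then Lipschitz convex functions which `H` preserves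
up to constants are affine. -/
theorem QuasiInvariant.affine [ProperSpace X] (hX : IsCAT0 X)
    (hmin : ActsMinimally G X) (hfix : NoFixedPointAtInfinity G X)
    {H : Subgroup G} (hcov : HasFiniteInvariantCovolume H) {f : X → ℝ} (hf : QuasiInvariant H f)
    {K : ℝ≥0} (hK : LipschitzWith K f) (hconv : GeodesicallyConvexFun f) :
    GeodesicallyAffineFun f := by
  rcases isEmpty_or_nonempty X with hemp | ⟨⟨o⟩⟩
  · exact fun x => isEmptyElim x
  let _ : MeasurableSpace (G ⧸ H) := borel _
  have : BorelSpace (G ⧸ H) := ⟨rfl⟩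
  obtain ⟨μ, hμ, hfin, hinv⟩ := hcov
  have hi := hf.integrable_translateDiff μ hK o
  have hconst := hmin.eq_of_quasiInvariant hX hfix
    (hf.lipschitzWith_integral_translateDiff μ hK o)
    (hf.convex_integral_translateDiff μ hK hconv o)
    (hf.quasiInvariant_integral_translateDiff μ hK o)
  choose γ hγ using fun p : X × X => hX.exists_geodesic p.1 p.2
  have hhalf : (1 / 2 : ℝ) ∈ Icc (0 : ℝ) 1 := ⟨by norm_num, by norm_num⟩
  have hae : ∀ p : X × X, ∀ᵐ q ∂μ, hf.translateDiff o (γ p (1 / 2)) q =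
      hf.translateDiff o p.1 q / 2 + hf.translateDiff o p.2 q / 2 := by
    intro p
    have hle : ∀ q, hf.translateDiff o (γ p (1 / 2)) q ≤
        hf.translateDiff o p.1 q / 2 + hf.translateDiff o p.2 q / 2 := fun q => by
      have := hf.translateDiff_le hconv o (hγ p) hhalf q
      linarith
    refine (integral_eq_iff_of_ae_le (hi _) (((hi p.1).div_const 2).add ((hi p.2).div_const 2))
      (.of_forall hle)).1 ?_
    have h₁ : ∫ q, (hf.translateDiff o p.1 q / 2 + hf.translateDiff o p.2 q / 2) ∂μ =
        ∫ q, hf.translateDiff o (γ p (1 / 2)) q ∂μ := by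
      rw [integral_add ((hi p.1).div_const 2) ((hi p.2).div_const 2), integral_div, integral_div,
        hconst p.1 (γ p (1 / 2)), hconst p.2 (γ p (1 / 2)), add_halves]
    exact h₁.symm
  have : Nonempty (X × X) := ⟨(o, o)⟩
  have : NeZero μ := ⟨hμ⟩
  -- The null set depends on the pair of endpoints. Countably many pairs share one good coset, and
  -- continuity of midpoints extends the equality to all pairs.
  obtain ⟨q, hq⟩ := (ae_all_iff.2 fun n => hae (TopologicalSpace.denseSeq (X × X) n)).exists
  induction q using QuotientGroup.induction_on with
  | H g =>
    have hγc : Continuous fun p : X × X => γ p (1 / 2) := by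
      refine (LipschitzWith.of_dist_le_mul (K := 1) fun p p' => ?_).continuous
      have h₁ := hX.dist_le (hγ p) (hγ p') hhalf
      have h₂ : dist p.1 p'.1 ≤ dist p p' := le_max_left _ _
      have h₃ : dist p.2 p'.2 ≤ dist p p' := le_max_right _ _
      rw [NNReal.coe_one]
      linarith
    have heq : (fun p : X × X => f (g⁻¹ • γ p (1 / 2))) =
        fun p => f (g⁻¹ • p.1) / 2 + f (g⁻¹ • p.2) / 2 := by
      have hfc := hK.continuous
      refine (TopologicalSpace.denseRange_denseSeq (X × X)).equalizer (by fun_prop)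
        (by fun_prop) ?_
      ext n
      have := hq n
      simp only [QuasiInvariant.translateDiff_mk] at this
      simp only [Function.comp]
      linarith
    refine hconv.affine_of_midpoint fun x y c hc => ?_
    have h₁ := congrFun heq (g • x, g • y)
    have h₂ := hX.dist_le (hγ (g • x, g • y)) (hc.smul g) hhalf
    simp only [dist_self, mul_zero, add_zero] at h₂
    rw [dist_le_zero] at h₂
    simp only [h₂, inv_smul_smul] at h₁
    exact h₁

/-- Subgroups of finite covolume act minimally. -/
theorem ActsMinimally.subgroup [ProperSpace X] (hX : IsCAT0 X)
    (hmin : ActsMinimally G X) (hfix : NoFixedPointAtInfinity G X)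
    {H : Subgroup G} (hcov : HasFiniteInvariantCovolume H) : ActsMinimally H X := by
  intro C hne hcl hconv hinv
  have hle : ∀ (h : H) (x : X), Metric.infDist (h • x) C ≤ Metric.infDist x C := fun h x => by
    refine le_of_forall_pos_le_add fun ε hε => ?_
    obtain ⟨p, hp, hxp⟩ :=
      (Metric.infDist_lt_iff hne).1 (lt_add_of_pos_right (Metric.infDist x C) hε)
    rw [← dist_smul h] at hxp
    exact (Metric.infDist_le_dist_of_mem (hinv h p hp)).trans hxp.le
  have heq : ∀ (h : H) (x : X), Metric.infDist (h • x) C = Metric.infDist x C := fun h x =>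
    (hle h x).antisymm (by simpa using hle h⁻¹ (h • x))
  have hcx := hX.convex_infDist hne hconv
  obtain ⟨y, hy⟩ := hne
  refine eq_univ_of_forall fun x => (hcl.mem_iff_infDist_zero ⟨y, hy⟩).2 ?_
  by_contra hx
  have hpos : 0 < Metric.infDist x C := lt_of_le_of_ne Metric.infDist_nonneg (Ne.symm hx)
  obtain ⟨c, hc⟩ := hX.exists_geodesic y x
  have hhalf : (1 / 2 : ℝ) ∈ Icc (0 : ℝ) 1 := ⟨by norm_num, by norm_num⟩
  -- `τ` is the value of the affine distance function at the midpoint. The truncation at `τ` takes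
  -- the values `τ`, `τ`, `2 * τ` at `y`, midpoint and `x`, so it is not affine.
  set τ := Metric.infDist x C / 2 with hτ
  have h₁ := QuasiInvariant.affine hX hmin hfix hcov (fun h => ⟨0, fun x => by rw [heq, add_zero]⟩)
    (Metric.lipschitz_infDist_pt C) hcx hc _ hhalf
  have h₂ := QuasiInvariant.affine hX hmin hfix hcov
    (f := fun x => max (Metric.infDist x C) τ)
    (fun h => ⟨0, fun x => by simp only [heq, add_zero]⟩)
    ((Metric.lipschitz_infDist_pt C).max_const τ) (hcx.max_const τ) hc _ hhalf
  have h₀ := Metric.infDist_zero_of_mem hy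
  simp only [h₀] at h₁
  simp only [h₁, h₀] at h₂
  rw [max_eq_right (by linarith), max_eq_right (by linarith), max_eq_left (by linarith)] at h₂
  linarith

end Averaging

/-! ### Busemann functions -/

section Busemann

open Filter Topology

variable {X : Type*} [MetricSpace X]

namespace GeodesicRay

/-- The Busemann function of a geodesic ray. -/
noncomputable def busemann (r : GeodesicRay X) (x : X) : ℝ :=
  ⨅ T : ℝ≥0, (dist x (r.toFun T) - T)

theorem tendsto_busemann (r : GeodesicRay X) (x : X) :
    Tendsto (fun T : ℝ≥0 => dist x (r.toFun T) - T) atTop (𝓝 (r.busemann x)) := by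
  refine tendsto_atTop_ciInf (fun T T' h => ?_) ⟨-dist x (r.toFun 0), ?_⟩
  · have h₁ := dist_triangle x (r.toFun T) (r.toFun T')
    have h' : (T : ℝ) ≤ T' := h
    rw [r.isometry.dist_eq, NNReal.dist_eq, abs_sub_comm, abs_of_nonneg (by linarith)] at h₁
    linarith
  · rintro _ ⟨T, rfl⟩
    have h₁ := dist_triangle_left (r.toFun 0) (r.toFun T) x
    rw [r.isometry.dist_eq, NNReal.dist_eq, NNReal.coe_zero, zero_sub, abs_neg, NNReal.abs_eq] at h₁
    simp only
    linarith

theorem lipschitzWith_busemann (r : GeodesicRay X) : LipschitzWith 1 r.busemann := by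
  refine LipschitzWith.of_le_add fun x y => ?_
  refine le_of_tendsto_of_tendsto' (r.tendsto_busemann x)
    ((r.tendsto_busemann y).add_const (dist x y)) fun T => ?_
  linarith [dist_triangle x y (r.toFun T)]

theorem busemann_apply (r : GeodesicRay X) (u : ℝ≥0) : r.busemann (r.toFun u) = -u := by
  refine tendsto_nhds_unique (r.tendsto_busemann _) (tendsto_const_nhds.congr' ?_)
  filter_upwards [eventually_ge_atTop u] with T hT
  have : (u : ℝ) ≤ T := hT
  rw [r.isometry.dist_eq, NNReal.dist_eq, abs_sub_comm, abs_of_nonneg (by linarith)]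
  ring

theorem convex_busemann (hX : IsCAT0 X) (r : GeodesicRay X) :
    GeodesicallyConvexFun r.busemann := by
  intro x y c hc t ht
  refine le_of_tendsto_of_tendsto' (r.tendsto_busemann _)
    (((r.tendsto_busemann x).const_mul (1 - t)).add ((r.tendsto_busemann y).const_mul t))
    fun T => ?_
  have hconst : IsGeodesicFromTo (fun _ => r.toFun T) (r.toFun T) (r.toFun T) :=
    ⟨rfl, rfl, fun _ _ _ _ => by simp⟩
  have := hX.dist_le hc hconst ht
  linarith

/-- Write the distances to the points at time `T` as `T` plus a convergent term. In the four-point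
inequality the `T ^ 2` cancel, and division by `T` leaves twice the claim in the limit. -/
theorem Asymptotic.busemann_sub_le (hX : IsCAT0 X) {r r' : GeodesicRay X} (h : r.Asymptotic r')
    (x y : X) : r.busemann x - r.busemann y ≤ r'.busemann x - r'.busemann y := by
  obtain ⟨K, hK⟩ := h
  have hT : Tendsto (fun T : ℝ≥0 => (T : ℝ)⁻¹) atTop (𝓝 0) :=
    tendsto_inv_atTop_zero.comp (NNReal.tendsto_coe_atTop.2 tendsto_id)
  have l₁ := r.tendsto_busemann x
  have l₂ := r'.tendsto_busemann y
  have l₃ := r.tendsto_busemann y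
  have l₄ := r'.tendsto_busemann x
  have l := (((l₁.add l₂).sub (l₃.add l₄)).const_mul 2).add
    (((((l₁.pow 2).add (l₂.pow 2)).sub ((l₃.pow 2).add (l₄.pow 2))).sub_const
      (dist x y ^ 2 + K ^ 2)).mul hT)
  have := le_of_tendsto l (b := 0) (by
    filter_upwards [eventually_gt_atTop 0] with T hT0
    have hT0' : (0 : ℝ) < T := hT0
    have h₁ := hX.dist_sq_add_dist_sq_le x y (r.toFun T) (r'.toFun T)
    have h₂ := pow_le_pow_left₀ dist_nonneg (hK T) 2
    rw [dist_comm (r'.toFun T) x] at h₁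
    have h₃ : (2 * (dist x (r.toFun T) - T + (dist y (r'.toFun T) - T) -
        (dist y (r.toFun T) - T + (dist x (r'.toFun T) - T))) +
        ((dist x (r.toFun T) - T) ^ 2 + (dist y (r'.toFun T) - T) ^ 2 -
          ((dist y (r.toFun T) - T) ^ 2 + (dist x (r'.toFun T) - T) ^ 2) -
          (dist x y ^ 2 + K ^ 2)) * (T : ℝ)⁻¹) =
        (dist x (r.toFun T) ^ 2 + dist y (r'.toFun T) ^ 2 - dist y (r.toFun T) ^ 2 -
          dist x (r'.toFun T) ^ 2 - dist x y ^ 2 - K ^ 2) * (T : ℝ)⁻¹ := by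
      field_simp
      ring
    rw [h₃]
    exact mul_nonpos_of_nonpos_of_nonneg (by linarith) (by positivity))
  linarith

theorem busemann_translate {G : Type*} [Group G] [MulAction G X] [IsIsometricSMul G X] (g : G)
    (r : GeodesicRay X) (x : X) : (r.translate g).busemann (g • x) = r.busemann x := by
  simp only [busemann, translate, dist_smul]

/-- A group fixing the endpoint of a ray preserves its Busemann function up to constants. -/
theorem quasiInvariant_busemann (hX : IsCAT0 X) {G : Type*} [Group G] [MulAction G X]
    [IsIsometricSMul G X] {r : GeodesicRay X} (h : ∀ g : G, (r.translate g).Asymptotic r) :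
    QuasiInvariant G r.busemann := by
  intro g
  refine ⟨r.busemann (r.toFun 0) - (r.translate g).busemann (r.toFun 0), fun x => ?_⟩
  have h₁ := (h g).busemann_sub_le hX (g • x) (r.toFun 0)
  have h₂ := (h g).busemann_sub_le hX (r.toFun 0) (g • x)
  rw [busemann_translate] at h₁ h₂
  linarith

end GeodesicRay

end Busemann

/-! ### Splitting off a line along an affine function -/

section Splitting

open Filter Topology

/-- A convex function on the line of sublinear growth is constant. -/
theorem eq_of_convex_of_le_sqrt {h : ℝ → ℝ}
    (hconv : ∀ a b : ℝ, ∀ t ∈ Icc (0 : ℝ) 1, h ((1 - t) * a + t * b) ≤ (1 - t) * h a + t * h b)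
    {A B : ℝ} (hle : ∀ t, h t ≤ A + B * √|t|) (t : ℝ) : h t = h 0 := by
  have key : ∀ t, h t ≤ h 0 := by
    intro t
    have l : Tendsto (fun w : ℝ => (1 - w) * h 0 + (w * A + B * (√w * √|t|))) (𝓝[>] 0)
        (𝓝 ((1 - 0) * h 0 + (0 * A + B * (√0 * √|t|)))) :=
      Continuous.continuousWithinAt (by fun_prop)
    rw [Real.sqrt_zero] at l
    have := ge_of_tendsto l (b := h t) (by
      filter_upwards [Ioc_mem_nhdsGT (zero_lt_one' ℝ)] with w hw
      -- View `t` as a convex combination of `0` and the far point `t / w`; the growth bound makes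
      -- the latter's share vanish as `w` tends to `0`.
      have h₁ := hconv 0 (t / w) w ⟨hw.1.le, hw.2⟩
      rw [mul_zero, zero_add, mul_div_cancel₀ _ hw.1.ne'] at h₁
      have h₂ := mul_le_mul_of_nonneg_left (hle (t / w)) hw.1.le
      have h₃ : w * √|t / w| = √w * √|t| := by
        rw [abs_div, abs_of_pos hw.1, Real.sqrt_div (abs_nonneg t)]
        have : 0 < √w := Real.sqrt_pos.2 hw.1
        field_simp
        rw [Real.sq_sqrt hw.1.le, mul_comm]
      rw [← h₃]
      linarith)
    linarith
  refine (key t).antisymm ?_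
  have h₁ := hconv t (-t) (1 / 2) ⟨by norm_num, by norm_num⟩
  rw [show (1 - 1 / 2) * t + 1 / 2 * -t = 0 by ring] at h₁
  linarith [key (-t)]

variable {X : Type*} [MetricSpace X]

/-- `Φ` moves each point along a line on which `φ` grows at unit speed. -/
def IsUnitGradientFlow (φ : X → ℝ) (Φ : ℝ → X → X) : Prop :=
  ∀ t x, dist x (Φ t x) ≤ |t| ∧ φ (Φ t x) = φ x + t

namespace IsUnitGradientFlow

variable {φ : X → ℝ} {Φ : ℝ → X → X}

theorem dist_eq (hΦ : IsUnitGradientFlow φ Φ) (hφ : LipschitzWith 1 φ) (t : ℝ) (x : X) :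
    dist x (Φ t x) = |t| := by
  refine (hΦ t x).1.antisymm ?_
  have h := hφ.dist_le_mul (Φ t x) x
  rwa [(hΦ t x).2, Real.dist_eq, add_sub_cancel_left, NNReal.coe_one, one_mul, dist_comm] at h

/-- For two candidates, the midpoint is on the same level, hence at distance at least `|t|` from
`x`; the CN inequality then makes them equal. This uniqueness yields the group law of the flow. -/
theorem eq_of_dist_le (hΦ : IsUnitGradientFlow φ Φ) (hX : IsCAT0 X) (hφ : LipschitzWith 1 φ)
    (haff : GeodesicallyAffineFun φ) {t : ℝ} {x y : X} (hd : dist x y ≤ |t|)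
    (hy : φ y = φ x + t) : y = Φ t x := by
  obtain ⟨c, hc⟩ := hX.exists_geodesic y (Φ t x)
  have h₁ := haff hc (1 / 2) ⟨by norm_num, by norm_num⟩
  have h₂ := hφ.dist_le_mul (c (1 / 2)) x
  rw [h₁, hy, (hΦ t x).2, Real.dist_eq, NNReal.coe_one, one_mul, dist_comm,
    show (1 - 1 / 2) * (φ x + t) + 1 / 2 * (φ x + t) - φ x = t by ring] at h₂
  have h₃ := hX.dist_mid_sq_le x hc
  have h₄ := pow_le_pow_left₀ (abs_nonneg t) h₂ 2
  have h₅ := pow_le_pow_left₀ dist_nonneg hd 2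
  rw [hΦ.dist_eq hφ] at h₃
  have h₆ : dist y (Φ t x) ^ 2 ≤ 0 := by linarith
  exact dist_eq_zero.1 (pow_eq_zero_iff two_ne_zero |>.1 (h₆.antisymm (sq_nonneg _)))

theorem zero_apply (hΦ : IsUnitGradientFlow φ Φ) (x : X) : Φ 0 x = x := by
  have := (hΦ 0 x).1
  rw [abs_zero, dist_le_zero] at this
  exact this.symm

theorem neg_apply_apply (hΦ : IsUnitGradientFlow φ Φ) (hX : IsCAT0 X) (hφ : LipschitzWith 1 φ)
    (haff : GeodesicallyAffineFun φ) (t : ℝ) (x : X) : Φ (-t) (Φ t x) = x := by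
  refine (hΦ.eq_of_dist_le hX hφ haff ?_ ?_).symm
  · rw [dist_comm, abs_neg]
    exact (hΦ t x).1
  · rw [(hΦ t x).2]
    ring

theorem add_apply (hΦ : IsUnitGradientFlow φ Φ) (hX : IsCAT0 X) (hφ : LipschitzWith 1 φ)
    (haff : GeodesicallyAffineFun φ) (s t : ℝ) (x : X) : Φ s (Φ t x) = Φ (s + t) x := by
  have key : ∀ (s t : ℝ) (x : X), |s| + |t| = |s + t| → Φ s (Φ t x) = Φ (s + t) x := by
    intro s t x h
    refine hΦ.eq_of_dist_le hX hφ haff ?_ ?_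
    · linarith [dist_triangle x (Φ t x) (Φ s (Φ t x)), (hΦ t x).1, (hΦ s (Φ t x)).1]
    · rw [(hΦ s _).2, (hΦ t x).2]
      ring
  have hneg := hΦ.neg_apply_apply hX hφ haff
  rcases le_or_gt 0 (s * t) with h | h
  · exact key s t x (abs_add_eq_add_abs_iff s t |>.2 (mul_nonneg_iff.1 h)).symm
  -- For opposite signs, one of the pairs `s + t, -t` and `-s, s + t` has equal signs; apply `key`
  -- to it and cancel.
  rcases le_total 0 ((s + t) * -t) with h' | h'
  · have := key (s + t) (-t) (Φ t x)
      (abs_add_eq_add_abs_iff _ _ |>.2 (mul_nonneg_iff.1 h')).symm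
    rw [hneg, add_neg_cancel_right] at this
    exact this.symm
  · have h'' : 0 ≤ -s * (s + t) := by
      have ht : t ≠ 0 := by
        rintro rfl
        simp at h
      have h₁ : 0 ≤ -s * (s + t) * t ^ 2 := by nlinarith
      exact nonneg_of_mul_nonneg_left h₁ (by positivity)
    have := key (-s) (s + t) x (abs_add_eq_add_abs_iff _ _ |>.2 (mul_nonneg_iff.1 h'')).symm
    rw [neg_add_cancel_left] at this
    have h₁ := hneg (-s) (Φ (s + t) x)
    rwa [neg_neg, this] at h₁

theorem isometry_orbit (hΦ : IsUnitGradientFlow φ Φ) (hX : IsCAT0 X) (hφ : LipschitzWith 1 φ)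
    (haff : GeodesicallyAffineFun φ) (x : X) : Isometry fun t => Φ t x := by
  refine Isometry.of_dist_eq fun a b => ?_
  have h := hΦ.add_apply hX hφ haff (b - a) a x
  rw [sub_add_cancel] at h
  rw [← h, hΦ.dist_eq hφ, Real.dist_eq, abs_sub_comm]

/-- The flow preserves distances between points on the same level. -/
theorem dist_apply_apply (hΦ : IsUnitGradientFlow φ Φ) (hX : IsCAT0 X) (hφ : LipschitzWith 1 φ)
    (haff : GeodesicallyAffineFun φ) {x y : X} (hxy : φ x = φ y) (t : ℝ) :
    dist (Φ t x) (Φ t y) = dist x y := by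
  -- The midpoint of the two moved points is at distance at least `|t|` from `x`; with the CN
  -- inequality this bounds the square of their distance linearly in `|t|`.
  have h := eq_of_convex_of_le_sqrt (h := fun t => dist (Φ t x) (Φ t y))
    (A := 2 * dist x y) (B := 2 * √(dist x y)) (fun a b t ht => hX.dist_le
      (IsGeodesicFromTo.of_isometry (hΦ.isometry_orbit hX hφ haff x) a b)
      (IsGeodesicFromTo.of_isometry (hΦ.isometry_orbit hX hφ haff y) a b) ht) (fun t => by
    obtain ⟨c, hc⟩ := hX.exists_geodesic (Φ t x) (Φ t y)
    have h₁ := haff hc (1 / 2) ⟨by norm_num, by norm_num⟩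
    have h₂ := hφ.dist_le_mul (c (1 / 2)) x
    rw [h₁, (hΦ t x).2, (hΦ t y).2, ← hxy, Real.dist_eq, NNReal.coe_one, one_mul, dist_comm,
      show (1 - 1 / 2) * (φ x + t) + 1 / 2 * (φ x + t) - φ x = t by ring] at h₂
    have h₃ := hX.dist_mid_sq_le x hc
    have h₄ := pow_le_pow_left₀ (abs_nonneg t) h₂ 2
    have h₅ := dist_triangle x y (Φ t y)
    rw [hΦ.dist_eq hφ] at h₅ h₃
    have h₆ := pow_le_pow_left₀ dist_nonneg h₅ 2
    refine abs_le_of_sq_le_sq' ?_ (by positivity) |>.2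
    have e : (2 * dist x y + 2 * √(dist x y) * √|t|) ^ 2 = 4 * dist x y ^ 2 +
        8 * dist x y * (√(dist x y) * √|t|) + 4 * (√(dist x y) ^ 2 * √|t| ^ 2) := by ring
    rw [e, Real.sq_sqrt dist_nonneg, Real.sq_sqrt (abs_nonneg t)]
    have h₇ : 0 ≤ dist x y * (√(dist x y) * √|t|) := by positivity
    nlinarith [sq_nonneg (dist x y)]) t
  simpa only [hΦ.zero_apply] using h

/-- Pythagoras: subtracting `t ^ 2` from the squared distance leaves a function that is convex by CN
and bounded above by the four-point inequality, hence constant. -/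
theorem dist_apply_sq (hΦ : IsUnitGradientFlow φ Φ) (hX : IsCAT0 X) (hφ : LipschitzWith 1 φ)
    (haff : GeodesicallyAffineFun φ) {x y : X} (hxy : φ x = φ y) (t : ℝ) :
    dist x (Φ t y) ^ 2 = t ^ 2 + dist x y ^ 2 := by
  have h := eq_of_convex_of_le_sqrt (h := fun t => dist x (Φ t y) ^ 2 - t ^ 2)
    (A := 2 * dist x y ^ 2) (B := 0) (fun a b t ht => by
      have hiso := hΦ.isometry_orbit hX hφ haff y
      have h₁ := hX.dist_sq_le x (IsGeodesicFromTo.of_isometry hiso a b) ht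
      have h₂ := hiso.dist_eq a b
      rw [h₂, Real.dist_eq, sq_abs] at h₁
      nlinarith) (fun t => by
      have h₁ := hX.dist_sq_add_dist_sq_le x y (Φ t y) (Φ t x)
      have h₂ := hφ.dist_le_mul (Φ t x) y
      rw [(hΦ t x).2, hxy, Real.dist_eq, add_sub_cancel_left, NNReal.coe_one, one_mul,
        dist_comm] at h₂
      have h₃ := pow_le_pow_left₀ (abs_nonneg t) h₂ 2
      rw [hΦ.dist_eq hφ, dist_comm (Φ t x) x, hΦ.dist_eq hφ,
        hΦ.dist_apply_apply hX hφ haff hxy.symm, dist_comm y x] at h₁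
      rw [sq_abs] at h₁ h₃
      linarith) t
  simp only [hΦ.zero_apply] at h
  linarith

/-- The flow identifies `X` with the product of a line and a level set. -/
theorem nonempty_isometryEquiv (hΦ : IsUnitGradientFlow φ Φ) (hX : IsCAT0 X)
    (hφ : LipschitzWith 1 φ) (haff : GeodesicallyAffineFun φ) :
    Nonempty (X ≃ᵢ WithLp 2 (EuclideanSpace ℝ (Fin 1) × {x : X // φ x = 0})) := by
  have hadd := hΦ.add_apply hX hφ haff
  let e : WithLp 2 (EuclideanSpace ℝ (Fin 1) × {x : X // φ x = 0}) → X :=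
    fun p => Φ (p.fst 0) p.snd
  have hiso : Isometry e := by
    refine Isometry.of_dist_eq fun p q => ?_
    have h₁ : e q = Φ (q.fst 0 - p.fst 0) (Φ (p.fst 0) q.snd) := by
      rw [hadd, sub_add_cancel]
    have h₂ : φ (p.snd : X) = φ (q.snd : X) := p.snd.2.trans q.snd.2.symm
    have h₃ := hΦ.dist_apply_sq hX hφ haff (x := e p) (y := Φ (p.fst 0) q.snd)
      (by rw [(hΦ _ _).2, (hΦ _ _).2, h₂]) (q.fst 0 - p.fst 0)
    rw [← h₁, hΦ.dist_apply_apply hX hφ haff h₂] at h₃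
    rw [WithLp.prod_dist_eq_add (by norm_num)]
    norm_num
    rw [← Real.sqrt_eq_rpow, EuclideanSpace.dist_eq, Fin.sum_univ_one,
      Real.sq_sqrt (sq_nonneg _), Subtype.dist_eq, Real.dist_eq, sq_abs, ← neg_sub, neg_sq, ← h₃,
      Real.sqrt_sq dist_nonneg]
  refine ⟨(IsometryEquiv.mk' e (fun x => WithLp.toLp 2 (!₂[φ x], ⟨Φ (-φ x) x, ?_⟩))
    (fun x => ?_) hiso).symm⟩
  · rw [(hΦ _ _).2, add_neg_cancel]
  · change Φ (φ x) (Φ (-φ x) x) = x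
    rw [hadd, add_neg_cancel, hΦ.zero_apply]

end IsUnitGradientFlow

/-- If an affine function quasi-invariant under a minimal action has slope `1` along a ray, then
it has slope `1` along a line through any point. -/
theorem ActsMinimally.exists_isUnitGradientFlow {G : Type*} [Group G] [MulAction G X]
    [IsIsometricSMul G X] [ProperSpace X] (hX : IsCAT0 X) (hmin : ActsMinimally G X)
    {φ : X → ℝ} (hφ : LipschitzWith 1 φ) (haff : GeodesicallyAffineFun φ)
    (hG : QuasiInvariant G φ) (r : GeodesicRay X) (hr : ∀ u : ℝ≥0, φ (r.toFun u) = u) :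
    ∃ Φ : ℝ → X → X, IsUnitGradientFlow φ Φ := by
  have key : ∀ t x, ∃ y, dist x y ≤ |t| ∧ φ y = φ x + t := by
    intro t
    -- The points that can be moved by `t` form an invariant closed convex set: affinity of `φ`
    -- gives convexity, properness closedness, and the ray, run forwards or backwards, a point.
    have huniv := hmin {x | ∃ y, dist x y ≤ |t| ∧ φ y = φ x + t} ?_ ?_ ?_ ?_
    · exact fun x => huniv.ge (mem_univ x)
    · rcases le_total 0 t with h | h
      · lift t to ℝ≥0 using h
        refine ⟨r.toFun 0, r.toFun t, ?_, ?_⟩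
        · rw [r.isometry.dist_eq, NNReal.dist_eq]
          simp
        · rw [hr, hr, NNReal.coe_zero, zero_add]
      · obtain ⟨u, rfl⟩ : ∃ u : ℝ≥0, t = -u := ⟨⟨-t, by linarith⟩, (neg_neg t).symm⟩
        refine ⟨r.toFun u, r.toFun 0, ?_, ?_⟩
        · rw [r.isometry.dist_eq, NNReal.dist_eq]
          simp
        · rw [hr, hr, NNReal.coe_zero, add_neg_cancel]
    · refine IsSeqClosed.isClosed fun u x hu hux => ?_
      choose v hv₁ hv₂ using hu
      obtain ⟨R, hR⟩ := (Metric.isBounded_range_of_tendsto u hux).subset_closedBall x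
      have hmem : ∀ n, v n ∈ Metric.closedBall x (R + |t|) := fun n => by
        have h₁ : dist (u n) x ≤ R := hR (mem_range_self n)
        rw [Metric.mem_closedBall]
        linarith [dist_triangle_left (v n) x (u n), hv₁ n]
      obtain ⟨y, -, ψ, hψ, hy⟩ := (isCompact_closedBall x (R + |t|)).tendsto_subseq hmem
      have hux' := hux.comp hψ.tendsto_atTop
      refine ⟨y, le_of_tendsto' (hux'.dist hy) fun n => hv₁ _, ?_⟩
      refine tendsto_nhds_unique ((hφ.continuous.tendsto y).comp hy) ?_
      refine (((hφ.continuous.tendsto x).comp hux').add_const t).congr fun n => ?_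
      exact (hv₂ _).symm
    · rintro x ⟨x', hx₁, hx₂⟩ y ⟨y', hy₁, hy₂⟩ c hc τ hτ
      obtain ⟨d, hd⟩ := hX.exists_geodesic x' y'
      refine ⟨d τ, (hX.dist_le hc hd hτ).trans ?_, ?_⟩
      · nlinarith [hτ.1, hτ.2]
      · rw [haff hc τ hτ, haff hd τ hτ, hx₂, hy₂]
        ring
    · rintro g x ⟨y, hy₁, hy₂⟩
      obtain ⟨a, ha⟩ := hG g
      refine ⟨g • y, by rwa [dist_smul], ?_⟩
      rw [ha, ha, hy₂]
      ring
  choose Φ hΦ using key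
  exact ⟨Φ, hΦ⟩

end Splitting

theorem theorem3p1 {G X : Type*}
    [Group G] [TopologicalSpace G] [IsTopologicalGroup G] [LocallyCompactSpace G]
    [MetricSpace X] [ProperSpace X]
    [MulAction G X] [IsIsometricSMul G X] [ContinuousSMul G X]
    (hX : IsCAT0 X) (hE : WithoutEuclideanFactor X)
    (hmin : ActsMinimally G X) (hfix : NoFixedPointAtInfinity G X)
    (H : Subgroup G) (hclosed : IsClosed (H : Set G)) (hcov : HasFiniteInvariantCovolume H) :
    ActsMinimally H X ∧ NoFixedPointAtInfinity H X := by
  have hminH := hmin.subgroup hX hfix hcov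
  refine ⟨hminH, ?_⟩
  rintro ⟨ξ, hξ⟩
  induction ξ using Quotient.inductionOn with
  | h r =>
    have hq : QuasiInvariant H r.busemann :=
      GeodesicRay.quasiInvariant_busemann hX fun h => Quotient.exact (hξ h)
    have haff := hq.affine hX hmin hfix hcov r.lipschitzWith_busemann (r.convex_busemann hX)
    -- The sign is changed so that the function increases along `r`.
    have hLip : LipschitzWith 1 fun x => -r.busemann x := r.lipschitzWith_busemann.neg
    have haff' : GeodesicallyAffineFun fun x => -r.busemann x := fun x y c hc t ht => by
      simp only [haff hc t ht]
      ring
    obtain ⟨Φ, hΦ⟩ := hminH.exists_isUnitGradientFlow hX hLip haff'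
      (fun h => by
        obtain ⟨a, ha⟩ := hq h
        exact ⟨-a, fun x => by rw [ha, neg_add]⟩)
      r fun u => by rw [r.busemann_apply, neg_neg]
    exact (hΦ.nonempty_isometryEquiv hX hLip haff').elim (hE 1 _ le_rfl).false
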